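/- Let $\mathcal H_A,\mathcal H_B$ be finite-dimensional complex Hilbert spaces and $d_A=\dim\mathcal H_A$. A state $\rho=\rho^{AB}$ on $\mathcal H_A\otimes\mathcal H_B$ is a positive semidefinite operator of trace one; $\rho^A=\operatorname{tr}_B\rho$ and $\rho^B=\operatorname{tr}_A\rho$ are its reduced states (partial traces over $\mathcal H_B$ and $\mathcal H_A$ respectively). Let $\|X\|_1=\operatorname{tr}\sqrt{X^*X}$ be the trace norm, $S(\rho)=-\operatorname{tr}(\rho\log_2\rho)$ the von Neumann entropy (with $0\log_2 0=0$), $I(A:B)_\rho=S(\rho^A)+S(\rho^B)-S(\rho^{AB})$ the mutual information, $T(A:B)_\rho=\|\rho^{AB}-\rho^A\otimes\rho^B\|_1$ the trace distance correlation, and $h_b(x)=-x\log_2x-(1-x)\log_2(1-x)$ for $x\in[0,1]$ the binary entropy function. Let $\rho$ and $\sigma$ be states on $\mathcal H_A\otimes\mathcal H_B$ with $\delta=\|\rho^{AB}-\sigma^{AB}\|_1<1$. Then $$|I(A:B)_\rho-I(A:B)_\sigma|\le 6\,\delta\log_2 d_A+4\,h_b(\delta).$$ In particular, $\sigma^{AB}=\rho^A\otimes\rho^B$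 is a state with $I(A:B)_\sigma=0$ and $\|\rho^{AB}-\sigma^{AB}\|_1=T(A:B)_\rho$; hence, if $T(A:B)_\rho<1$, then $$I(A:B)_\rho\le 6\,T(A:B)_\rho\log_2 d_A+4\,h_b\big(T(A:B)_\rho\big).$$ -/

import Mathlib

open Matrix
open scoped Kronecker ComplexOrder

noncomputable section

namespace QInfo

variable {n A B : Type*} [Fintype n] [DecidableEq n] [Fintype A] [DecidableEq A]
  [Fintype B] [DecidableEq B]

/-- A state on the Hilbert space with orthonormal basis indexed by `n`: a positive semidefinite
matrix of trace one. -/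
def IsState (ρ : Matrix n n ℂ) : Prop := ρ.PosSemidef ∧ ρ.trace = 1

/-- The trace norm `‖X‖₁ = tr √(X* X)`. The square root is taken with the continuous functional
calculus of the Hermitian matrix `X* X`. -/
def traceNorm (X : Matrix n n ℂ) : ℝ := (cfc Real.sqrt (Xᴴ * X)).trace.re

/-- The von Neumann entropy `S(ρ) = - tr (ρ log₂ ρ)`. As `Real.logb 2 0 = 0`, zero eigenvalues
contribute `0`, the usual convention `0 log₂ 0 = 0`. -/
def entropy (ρ : Matrix n n ℂ) : ℝ := -(ρ * cfc (Real.logb 2) ρ).trace.re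

/-- The reduced matrix on the first factor (the second factor is traced out). -/
def reducedA (ρ : Matrix (A × B) (A × B) ℂ) : Matrix A A ℂ :=
  Matrix.of fun i j => ∑ k, ρ (i, k) (j, k)

/-- The reduced matrix on the second factor (the first factor is traced out). -/
def reducedB (ρ : Matrix (A × B) (A × B) ℂ) : Matrix B B ℂ :=
  Matrix.of fun i j => ∑ k, ρ (k, i) (k, j)

/-- The partial traces satisfy their characterization on elementary tensors. -/
theorem reducedA_kronecker {A B : Type*} [Fintype B] (x : Matrix A A ℂ) (y : Matrix B B ℂ) :
    reducedA (x ⊗ₖ y) = y.trace • x := by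
  ext i j
  simp [reducedA, Matrix.trace, Finset.mul_sum, mul_comm]

theorem reducedB_kronecker {A B : Type*} [Fintype A] (x : Matrix A A ℂ) (y : Matrix B B ℂ) :
    reducedB (x ⊗ₖ y) = x.trace • y := by
  ext i j
  simp [reducedB, Matrix.trace, Finset.sum_mul]

/-- The product `ρ_A ⊗ ρ_B` of the reduced matrices. -/
def productOfReduced (ρ : Matrix (A × B) (A × B) ℂ) : Matrix (A × B) (A × B) ℂ :=
  reducedA ρ ⊗ₖ reducedB ρ

/-- The mutual information `I(A:B)_ρ = S(ρ_A) + S(ρ_B) - S(ρ)`. -/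
def mutualInfo (ρ : Matrix (A × B) (A × B) ℂ) : ℝ :=
  entropy (reducedA ρ) + entropy (reducedB ρ) - entropy ρ

/-- The trace distance correlation `T(A:B)_ρ = ‖ρ - ρ_A ⊗ ρ_B‖₁`. -/
def traceDistCorr (ρ : Matrix (A × B) (A × B) ℂ) : ℝ :=
  traceNorm (ρ - productOfReduced ρ)

/-- The binary entropy function, with logarithms in base two. -/
def binaryEntropy (x : ℝ) : ℝ := -x * Real.logb 2 x - (1 - x) * Real.logb 2 (1 - x)

end QInfo

end

/-!
Write `S(A|B) = S(AB) - S(B)`, so that `I(A:B) = S(A) - S(A|B)`. Both terms are concave in the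
state, and on a mixture they exceed the average by at most the binary entropy of the weights.
Concavity of `S(A|B) = -D(ρ ‖ 1 ⊗ ρ_B)` is joint convexity of the relative entropy, which holds
because, on the eigenvalues,
`p (log p - log q) = ∫ t in (0, ∞), (p² / (q + t p) - p / (1 + t))`,
and the operator version of `p² / (q + t p)` is a supremum of functionals that are jointly affine
in the two states.

For states `ρ` and `σ` with `ε = ‖ρ - σ‖₁ / 2`, the Jordan decomposition of `ρ - σ` provides states
`P` and `N` with `ρ + ε N = σ + ε P`. Normalized, this writes one state as a mixture in two ways;
concavity bounds the functional there from below and almost-affinity from above (the argument of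
Alicki, Fannes and Winter), so a functional of this kind with values in `[m, M]` changes by at most
`ε (M - m) + (1 + ε) h(ε / (1 + ε))`. Here `S(A)` ranges over `[0, log d_A]` and `S(A|B)` over
`[-log d_A, log d_A]`, and the second term is at most `h(2 ε) / 2 + 4 ε`. For `d_A ≥ 2` the excess
`4 ε` is absorbed by the leading term.
-/

noncomputable section

namespace QInfo

open Filter Topology
open scoped MatrixOrder

section Spectral

theorem cfc_map_pi {ι R : Type*} [Finite ι] [Ring R] [StarRing R] [Algebra ℝ R]
    [TopologicalSpace R] [ContinuousFunctionalCalculus ℝ R IsSelfAdjoint]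
    (φ : (ι → ℝ) →⋆ₐ[ℝ] R) (f : ℝ → ℝ) (p : ι → ℝ) : cfc f (φ p) = φ (f ∘ p) := by
  have := Fintype.ofFinite ι
  let P : Polynomial ℝ := Lagrange.interpolate (Finset.univ.image p) id f
  have eval_P (i : ι) : P.eval (p i) = f (p i) :=
    Lagrange.eval_interpolate_at_node f Function.injective_id.injOn
      (Finset.mem_image_of_mem p (Finset.mem_univ i))
  have spectrum_subset : spectrum ℝ (φ p) ⊆ Set.range p := by
    refine (AlgHom.spectrum_apply_subset φ p).trans fun x hx => ?_
    have spectrum_apply (i : ι) : spectrum ℝ (p i) = {p i} := spectrum.scalar_eq (p i)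
    simpa [Pi.spectrum_eq, spectrum_apply, eq_comm] using hx
  calc cfc f (φ p) = cfc P.eval (φ p) := by
        refine cfc_congr fun x hx => ?_
        obtain ⟨i, rfl⟩ := spectrum_subset hx
        exact (eval_P i).symm
    _ = Polynomial.aeval (φ p) P := cfc_polynomial P (φ p) ((IsSelfAdjoint.all p).map φ)
    _ = φ (f ∘ p) := by
        rw [Polynomial.aeval_algHom_apply φ p P]
        congr 1
        ext i
        simp [eval_P]

variable {n m : Type*} [Fintype n] [DecidableEq n] [Fintype m] [DecidableEq m]

/-- The Hermitian matrix `U diag(p) U*` with eigenvalues `p` and eigenvectors the columns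
of `U`, as a star algebra homomorphism in `p`. -/
def conjDiagonal (U : unitaryGroup n ℂ) : (n → ℝ) →⋆ₐ[ℝ] Matrix n n ℂ where
  toFun p := Unitary.conjStarAlgAut ℝ _ U (diagonal fun i => (p i : ℂ))
  map_one' := by simp
  map_mul' p q := by rw [← map_mul, diagonal_mul_diagonal]; simp
  map_zero' := by simp
  map_add' p q := by rw [← map_add, diagonal_add]; simp
  commutes' r := AlgEquivClass.commutes (Unitary.conjStarAlgAut ℝ (Matrix n n ℂ) U) r
  map_star' p := by
    rw [← map_star, star_eq_conjTranspose, diagonal_conjTranspose]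
    simp [Pi.star_def]

theorem conjDiagonal_apply (U : unitaryGroup n ℂ) (p : n → ℝ) :
    conjDiagonal U p = U * diagonal (fun i => (p i : ℂ)) * star (U : Matrix n n ℂ) := rfl

theorem exists_eq_conjDiagonal {M : Matrix n n ℂ} (hM : M.IsHermitian) :
    ∃ U p, M = conjDiagonal U p :=
  ⟨hM.eigenvectorUnitary, hM.eigenvalues, hM.spectral_theorem⟩

theorem trace_conjDiagonal (U : unitaryGroup n ℂ) (p : n → ℝ) :
    (conjDiagonal U p).trace.re = ∑ i, p i := by
  rw [conjDiagonal_apply, trace_mul_comm, ← Matrix.mul_assoc, Unitary.coe_star_mul_self,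
    Matrix.one_mul]
  simp [trace]

theorem conjDiagonal_nonneg_iff {U : unitaryGroup n ℂ} {p : n → ℝ} :
    0 ≤ conjDiagonal U p ↔ 0 ≤ p := by
  rw [nonneg_iff_posSemidef, conjDiagonal_apply,
    Unitary.isUnit_coe.posSemidef_star_right_conjugate_iff, posSemidef_diagonal_iff]
  simp [Pi.le_def]

theorem kronecker_conjDiagonal (U : unitaryGroup n ℂ) (V : unitaryGroup m ℂ) :
    ∃ W, ∀ p q,
      conjDiagonal U p ⊗ₖ conjDiagonal V q = conjDiagonal W fun i => p i.1 * q i.2 := by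
  refine ⟨⟨(U : Matrix n n ℂ) ⊗ₖ (V : Matrix m m ℂ), kronecker_mem_unitary U.2 V.2⟩,
    fun p q => ?_⟩
  simp only [conjDiagonal_apply, star_eq_conjTranspose, conjTranspose_kronecker, mul_kronecker_mul,
    diagonal_kronecker_diagonal, Complex.ofReal_mul]

theorem entropy_conjDiagonal (U : unitaryGroup n ℂ) (p : n → ℝ) :
    entropy (conjDiagonal U p) = -∑ i, p i * Real.logb 2 (p i) := by
  rw [entropy, cfc_map_pi, ← map_mul, trace_conjDiagonal]
  rfl

theorem traceNorm_conjDiagonal (U : unitaryGroup n ℂ) (p : n → ℝ) :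
    traceNorm (conjDiagonal U p) = ∑ i, |p i| := by
  rw [traceNorm, ← star_eq_conjTranspose, ← map_star, ← map_mul, cfc_map_pi, trace_conjDiagonal]
  simp [Real.sqrt_mul_self_eq_abs]

/-- `overlap U V i j = |⟨uᵢ, vⱼ⟩|²`, where `uᵢ` and `vⱼ` are the columns of `U` and `V`. -/
def overlap (U V : unitaryGroup n ℂ) (i j : n) : ℝ :=
  Complex.normSq ((star U * V : unitaryGroup n ℂ).1 i j)

theorem overlap_nonneg (U V : unitaryGroup n ℂ) (i j : n) : 0 ≤ overlap U V i j :=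
  Complex.normSq_nonneg _

theorem sum_overlap (U V : unitaryGroup n ℂ) (i : n) : ∑ j, overlap U V i j = 1 := by
  have row_norm := congrFun₂ (Unitary.coe_mul_star_self (star U * V)) i i
  rw [mul_apply, one_apply_eq] at row_norm
  simp only [Unitary.coe_star, star_apply, RCLike.star_def, Complex.mul_conj] at row_norm
  exact_mod_cast row_norm

theorem trace_diagonal_mul_mul_diagonal_mul_conjTranspose (p q : n → ℝ) (X Y : Matrix n n ℂ) :
    (diagonal (fun i => (p i : ℂ)) * X * diagonal (fun j => (q j : ℂ)) * Yᴴ).trace.re =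
      ∑ i, ∑ j, p i * q j * (X i j * star (Y i j)).re := by
  rw [trace, Complex.re_sum]
  refine Finset.sum_congr rfl fun i _ => ?_
  rw [diag_apply, mul_apply, Complex.re_sum]
  refine Finset.sum_congr rfl fun j _ => ?_
  rw [mul_diagonal, diagonal_mul, conjTranspose_apply, ← Complex.re_ofReal_mul]
  push_cast
  congr 1
  ring

end Spectral

section ScalarResolvent

open MeasureTheory

variable {p q t : ℝ}

theorem two_mul_sub_le_resolvent (hp : 0 ≤ p) (hq : 0 ≤ q) (ht : 0 < t) (z w : ℂ) :
    2 * (p * (z * star w).re) - q * Complex.normSq z - t * (p * Complex.normSq z) ≤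
      Complex.normSq w * (p ^ 2 / (q + t * p)) := by
  rcases (by positivity : 0 ≤ q + t * p).eq_or_lt with h | h
  · obtain rfl : q = 0 := by nlinarith
    obtain rfl : p = 0 := by simpa [ht.ne'] using h.symm
    simp
  · rw [← mul_div_assoc, le_div_iff₀ h]
    simp only [RCLike.star_def, Complex.mul_re, Complex.conj_re, Complex.conj_im,
      Complex.normSq_apply]
    nlinarith [sq_nonneg ((q + t * p) * z.re - p * w.re), sq_nonneg ((q + t * p) * z.im - p * w.im)]

theorem two_mul_sub_eq_resolvent (h : q + t * p = 0 → p = 0) {z w : ℂ}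
    (hz : z = (p / (q + t * p) : ℝ) * w) :
    2 * (p * (z * star w).re) - q * Complex.normSq z - t * (p * Complex.normSq z) =
      Complex.normSq w * (p ^ 2 / (q + t * p)) := by
  have hd : (q + t * p) * (p / (q + t * p)) = p := mul_div_cancel_of_imp' h
  rw [hz, pow_two, mul_div_assoc]
  generalize p / (q + t * p) = r at hd ⊢
  simp only [RCLike.star_def, Complex.mul_re, Complex.mul_im, Complex.conj_re, Complex.conj_im,
    Complex.normSq_apply, Complex.ofReal_re, Complex.ofReal_im]
  linear_combination -(r * (w.re ^ 2 + w.im ^ 2)) * hd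

theorem tendsto_log_add_mul_sub_log_one_add (hp : 0 < p) (q : ℝ) :
    Tendsto (fun t : ℝ => Real.log (q + t * p) - Real.log (1 + t)) atTop (𝓝 (Real.log p)) := by
  have ratio : Tendsto (fun t : ℝ => (q - p) * (1 + t)⁻¹ + p) atTop (𝓝 p) := by
    have inv : Tendsto (fun t : ℝ => (1 + t)⁻¹) atTop (𝓝 0) :=
      tendsto_inv_atTop_zero.comp (tendsto_atTop_add_const_left _ _ tendsto_id)
    simpa using (inv.const_mul (q - p)).add_const p
  refine (ratio.log hp.ne').congr' ?_
  filter_upwards [eventually_gt_atTop 0, eventually_gt_atTop (-q / p)] with t ht htq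
  have num_pos : 0 < q + t * p := by linarith [(div_lt_iff₀ hp).1 htq]
  rw [← Real.log_div num_pos.ne' (by positivity)]
  congr 1
  field_simp
  ring

theorem hasDerivAt_log_add_mul_sub_log_one_add (hp : 0 < p) (hq : 0 < q) (ht : 0 ≤ t) :
    HasDerivAt (fun t => p * (Real.log (q + t * p) - Real.log (1 + t)))
      (p ^ 2 / (q + t * p) - p / (1 + t)) t := by
  have left : HasDerivAt (fun t => q + t * p) p t := by
    simpa using ((hasDerivAt_id t).mul_const p).const_add q
  have right : HasDerivAt (fun t => 1 + t) 1 t := by simpa using (hasDerivAt_id t).const_add 1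
  refine (((left.log (by positivity)).sub (right.log (by positivity))).const_mul p).congr_deriv ?_
  ring

theorem integrableOn_resolvent_sub (hp : 0 ≤ p) (hq : 0 ≤ q) (h : q = 0 → p = 0) :
    IntegrableOn (fun t => p ^ 2 / (q + t * p) - p / (1 + t)) (Set.Ioi 0) := by
  rcases hp.eq_or_lt with rfl | hp
  · simp
  have hq := hq.lt_of_ne' (mt h hp.ne')
  have hderiv (t : ℝ) (ht : t ∈ Set.Ici 0) := hasDerivAt_log_add_mul_sub_log_one_add hp hq ht
  have hlim := (tendsto_log_add_mul_sub_log_one_add hp q).const_mul p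
  have factor (t : ℝ) (ht : t ∈ Set.Ioi 0) :
      p ^ 2 / (q + t * p) - p / (1 + t) = (p - q) * (p / ((q + t * p) * (1 + t))) := by
    have ht : 0 < t := ht
    field_simp
    ring
  have pos (t : ℝ) (ht : t ∈ Set.Ioi 0) : 0 ≤ p / ((q + t * p) * (1 + t)) := by
    have ht : 0 < t := ht
    positivity
  rcases le_total q p with hqp | hqp
  · exact integrableOn_Ioi_deriv_of_nonneg' hderiv (fun t ht => by
      rw [factor t ht]; exact mul_nonneg (sub_nonneg.2 hqp) (pos t ht)) hlim
  · exact integrableOn_Ioi_deriv_of_nonpos' hderiv (fun t ht => by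
      rw [factor t ht]; exact mul_nonpos_of_nonpos_of_nonneg (sub_nonpos.2 hqp) (pos t ht)) hlim

theorem integral_resolvent_sub (hp : 0 ≤ p) (hq : 0 ≤ q) (h : q = 0 → p = 0) :
    ∫ t in Set.Ioi 0, (p ^ 2 / (q + t * p) - p / (1 + t)) = p * (Real.log p - Real.log q) := by
  have hint := integrableOn_resolvent_sub hp hq h
  rcases hp.eq_or_lt with rfl | hp
  · simp
  have hq := hq.lt_of_ne' (mt h hp.ne')
  rw [integral_Ioi_of_hasDerivAt_of_tendsto'
    (fun t ht => hasDerivAt_log_add_mul_sub_log_one_add hp hq ht) hint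
    ((tendsto_log_add_mul_sub_log_one_add hp q).const_mul p)]
  simp [mul_sub]

end ScalarResolvent

section Overlap

variable {n : Type*} [Fintype n]

theorem trace_conjDiagonal_mul_mul_conjDiagonal_mul [DecidableEq n] (U V : unitaryGroup n ℂ)
    (p q : n → ℝ) (X Y : Matrix n n ℂ) :
    (conjDiagonal U p * X * conjDiagonal V q * Yᴴ).trace.re =
      ∑ i, ∑ j, p i * q j * ((star (U : Matrix n n ℂ) * X * V) i j *
        star ((star (U : Matrix n n ℂ) * Y * V) i j)).re := by
  rw [← trace_diagonal_mul_mul_diagonal_mul_conjTranspose]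
  simp only [conjDiagonal_apply, ← star_eq_conjTranspose, star_mul, star_star,
    Matrix.mul_assoc]
  rw [trace_mul_comm (U : Matrix n n ℂ)]
  simp only [Matrix.mul_assoc]

theorem trace_conjDiagonal_mul_conjDiagonal [DecidableEq n] (U V : unitaryGroup n ℂ)
    (p q : n → ℝ) :
    (conjDiagonal U p * conjDiagonal V q).trace.re =
      ∑ i, ∑ j, overlap U V i j * (p i * q j) := by
  have := trace_conjDiagonal_mul_mul_conjDiagonal_mul U V p q 1 1
  simp only [Matrix.mul_one, conjTranspose_one, RCLike.star_def, Complex.mul_conj,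
    Complex.ofReal_re] at this
  simp only [this, overlap, mul_comm (p _ * q _)]
  rfl

theorem trace_mul_nonneg {X Y : Matrix n n ℂ} (hX : 0 ≤ X) (hY : 0 ≤ Y) :
    0 ≤ (X * Y).trace.re := by
  classical
  obtain ⟨U, p, rfl⟩ := exists_eq_conjDiagonal hX.posSemidef.isHermitian
  obtain ⟨V, q, rfl⟩ := exists_eq_conjDiagonal hY.posSemidef.isHermitian
  rw [trace_conjDiagonal_mul_conjDiagonal]
  exact Finset.sum_nonneg fun i _ => Finset.sum_nonneg fun j _ =>
    mul_nonneg (overlap_nonneg U V i j)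
      (mul_nonneg (conjDiagonal_nonneg_iff.1 hX i) (conjDiagonal_nonneg_iff.1 hY j))

end Overlap

section Domination

variable {n : Type*}

/-- `ρ` and `σ` are positive semidefinite and `ρ` is bounded by a multiple of `σ`. This is the
condition under which the relative entropy of `ρ` and `σ` is finite. -/
structure IsDominated (ρ σ : Matrix n n ℂ) : Prop where
  left_nonneg : 0 ≤ ρ
  right_nonneg : 0 ≤ σ
  exists_le_smul : ∃ c : ℝ, 0 ≤ c ∧ ρ ≤ c • σ

namespace IsDominated

variable {ρ σ τ ρ₁ ρ₂ σ₁ σ₂ : Matrix n n ℂ}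

protected theorem refl (h : 0 ≤ ρ) : IsDominated ρ ρ :=
  ⟨h, h, 1, zero_le_one, (one_smul ℝ ρ).ge⟩

theorem mono_right [Finite n] (h : IsDominated ρ σ) (hστ : σ ≤ τ) : IsDominated ρ τ := by
  have := Fintype.ofFinite n
  obtain ⟨c, hc, hle⟩ := h.exists_le_smul
  exact ⟨h.left_nonneg, h.right_nonneg.trans hστ, c, hc,
    hle.trans (smul_le_smul_of_nonneg_left hστ hc)⟩

theorem smul_add_smul [Finite n] (h₁ : IsDominated ρ₁ σ₁) (h₂ : IsDominated ρ₂ σ₂) {a b : ℝ}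
    (ha : 0 ≤ a) (hb : 0 ≤ b) : IsDominated (a • ρ₁ + b • ρ₂) (a • σ₁ + b • σ₂) := by
  have := Fintype.ofFinite n
  obtain ⟨c, hc, hle₁⟩ := h₁.exists_le_smul
  obtain ⟨d, hd, hle₂⟩ := h₂.exists_le_smul
  refine ⟨add_nonneg (smul_nonneg ha h₁.left_nonneg) (smul_nonneg hb h₂.left_nonneg),
    add_nonneg (smul_nonneg ha h₁.right_nonneg) (smul_nonneg hb h₂.right_nonneg),
    c + d, add_nonneg hc hd, ?_⟩
  have le₁ : ρ₁ ≤ (c + d) • σ₁ :=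
    hle₁.trans (smul_le_smul_of_nonneg_right (by linarith) h₁.right_nonneg)
  have le₂ : ρ₂ ≤ (c + d) • σ₂ :=
    hle₂.trans (smul_le_smul_of_nonneg_right (by linarith) h₂.right_nonneg)
  calc a • ρ₁ + b • ρ₂ ≤ a • (c + d) • σ₁ + b • (c + d) • σ₂ := by gcongr
    _ = (c + d) • (a • σ₁ + b • σ₂) := by module

variable [Fintype n]

theorem trace_mul_eq_zero (h : IsDominated ρ σ) {X : Matrix n n ℂ} (hX : 0 ≤ X)
    (hσ : (σ * X).trace.re = 0) : (ρ * X).trace.re = 0 := by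
  obtain ⟨c, -, hle⟩ := h.exists_le_smul
  have := trace_mul_nonneg (sub_nonneg.2 hle) hX
  rw [Matrix.sub_mul, smul_mul, trace_sub, trace_smul, Complex.sub_re, Complex.smul_re, hσ,
    smul_zero] at this
  exact le_antisymm (by linarith) (trace_mul_nonneg h.left_nonneg hX)

theorem trace_eq_zero (h : IsDominated ρ σ) (hσ : σ.trace.re = 0) : ρ.trace.re = 0 := by
  classical
  simpa using h.trace_mul_eq_zero zero_le_one (by simpa using hσ)

theorem overlap_mul_eq_zero [DecidableEq n] {U V : unitaryGroup n ℂ} {p q : n → ℝ}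
    (h : IsDominated (conjDiagonal U p) (conjDiagonal V q)) (i : n) {j : n} (hj : q j = 0) :
    overlap U V i j * p i = 0 := by
  have hX : 0 ≤ conjDiagonal V (Pi.single j 1) :=
    conjDiagonal_nonneg_iff.2 (Pi.single_nonneg.2 zero_le_one)
  have := h.trace_mul_eq_zero hX (by
    rw [← map_mul, trace_conjDiagonal]
    simp [Pi.single_apply, hj])
  have hp := conjDiagonal_nonneg_iff.1 h.left_nonneg
  simp only [trace_conjDiagonal_mul_conjDiagonal, Pi.single_apply, mul_ite, mul_one, mul_zero,
    Finset.sum_ite_eq', Finset.mem_univ, if_true] at this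
  exact (Finset.sum_eq_zero_iff_of_nonneg fun k _ => mul_nonneg (overlap_nonneg U V k j) (hp k)).1
    this i (Finset.mem_univ i)

end IsDominated

end Domination

section ResolventForm

variable {n : Type*} [Fintype n] {t : ℝ} {ρ σ τ : Matrix n n ℂ}

/-- A functional, jointly affine in `ρ` and `σ`, whose supremum over `Z` is
`⟨ρ, (R_σ + t L_ρ)⁻¹ ρ⟩` for the left and right multiplications `L_ρ X = ρ X`, `R_σ X = X σ` and
the Hilbert–Schmidt inner product. -/
def resolventForm (t : ℝ) (ρ σ Z : Matrix n n ℂ) : ℝ :=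
  2 * (ρ * Z).trace.re - (Z * σ * Zᴴ).trace.re - t * (ρ * Z * Zᴴ).trace.re

/-- The supremum of `resolventForm`: the noncommutative version of `ρ² / (σ + t ρ)`. -/
def resolventSup (t : ℝ) (ρ σ : Matrix n n ℂ) : ℝ :=
  ⨆ Z, resolventForm t ρ σ Z

theorem resolventForm_smul_add_smul (t a b : ℝ) (ρ₁ ρ₂ σ₁ σ₂ Z : Matrix n n ℂ) :
    resolventForm t (a • ρ₁ + b • ρ₂) (a • σ₁ + b • σ₂) Z =
      a * resolventForm t ρ₁ σ₁ Z + b * resolventForm t ρ₂ σ₂ Z := by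
  simp only [resolventForm, Matrix.add_mul, Matrix.mul_add, Matrix.smul_mul, Matrix.mul_smul,
    trace_add, trace_smul, Complex.add_re, Complex.smul_re, smul_eq_mul]
  ring

theorem resolventForm_anti (hστ : σ ≤ τ) (Z : Matrix n n ℂ) :
    resolventForm t ρ τ Z ≤ resolventForm t ρ σ Z := by
  have := (le_iff.1 hστ).mul_mul_conjTranspose_same Z |>.trace_nonneg
  rw [Matrix.mul_sub, Matrix.sub_mul, trace_sub, sub_nonneg] at this
  have := (Complex.le_def.1 this).1
  unfold resolventForm
  linarith

theorem resolventForm_conjDiagonal [DecidableEq n] (t : ℝ) (U V : unitaryGroup n ℂ) (p q : n → ℝ)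
    (Z : Matrix n n ℂ) :
    resolventForm t (conjDiagonal U p) (conjDiagonal V q) Z =
      ∑ i, ∑ j, (2 * (p i * ((star (U : Matrix n n ℂ) * Z * V) i j *
          star ((star (U : Matrix n n ℂ) * V) i j)).re)
        - q j * Complex.normSq ((star (U : Matrix n n ℂ) * Z * V) i j)
        - t * (p i * Complex.normSq ((star (U : Matrix n n ℂ) * Z * V) i j))) := by
  have linear := trace_conjDiagonal_mul_mul_conjDiagonal_mul U V p 1 Z 1
  have quadratic_right := trace_conjDiagonal_mul_mul_conjDiagonal_mul U V 1 q Z Z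
  have quadratic_left := trace_conjDiagonal_mul_mul_conjDiagonal_mul U V p 1 Z Z
  simp only [map_one, conjTranspose_one, Pi.one_apply, mul_one,
    one_mul, RCLike.star_def, Complex.mul_conj, Complex.ofReal_re]
    at linear quadratic_right quadratic_left
  rw [resolventForm, linear, quadratic_right, quadratic_left]
  simp only [Finset.sum_sub_distrib, Finset.mul_sum, RCLike.star_def]

theorem isGreatest_resolventForm [DecidableEq n] (ht : 0 < t) {U V : unitaryGroup n ℂ} {p q : n → ℝ}
    (hp : 0 ≤ p) (hq : 0 ≤ q) :
    IsGreatest (Set.range (resolventForm t (conjDiagonal U p) (conjDiagonal V q)))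
      (∑ i, ∑ j, overlap U V i j * (p i ^ 2 / (q j + t * p i))) := by
  constructor
  · let z : Matrix n n ℂ := of fun i j =>
      ((p i / (q j + t * p i) : ℝ) : ℂ) * (star (U : Matrix n n ℂ) * V) i j
    have hz : star (U : Matrix n n ℂ) * (U * z * star (V : Matrix n n ℂ)) * V = z := by
      simp only [Matrix.mul_assoc, Unitary.coe_star_mul_self, Matrix.mul_one]
      rw [← Matrix.mul_assoc, Unitary.coe_star_mul_self, Matrix.one_mul]
    refine ⟨U * z * star (V : Matrix n n ℂ), ?_⟩
    rw [resolventForm_conjDiagonal, hz]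
    refine Finset.sum_congr rfl fun i _ => Finset.sum_congr rfl fun j _ =>
      two_mul_sub_eq_resolvent (fun h => ?_) rfl
    have : 0 ≤ p i := hp i
    have : 0 ≤ q j := hq j
    by_contra hne
    exact (by positivity : q j + t * p i ≠ 0) h
  · rintro _ ⟨Z, rfl⟩
    rw [resolventForm_conjDiagonal]
    exact Finset.sum_le_sum fun i _ => Finset.sum_le_sum fun j _ =>
      two_mul_sub_le_resolvent (hp i) (hq j) ht _ _

theorem resolventSup_conjDiagonal [DecidableEq n] (ht : 0 < t) {U V : unitaryGroup n ℂ}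
    {p q : n → ℝ} (hp : 0 ≤ p) (hq : 0 ≤ q) :
    resolventSup t (conjDiagonal U p) (conjDiagonal V q) =
      ∑ i, ∑ j, overlap U V i j * (p i ^ 2 / (q j + t * p i)) :=
  (isGreatest_resolventForm ht hp hq).csSup_eq

theorem resolventForm_le_resolventSup (ht : 0 < t) (hρ : 0 ≤ ρ) (hσ : 0 ≤ σ) (Z : Matrix n n ℂ) :
    resolventForm t ρ σ Z ≤ resolventSup t ρ σ := by
  classical
  obtain ⟨U, p, rfl⟩ := exists_eq_conjDiagonal hρ.posSemidef.isHermitian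
  obtain ⟨V, q, rfl⟩ := exists_eq_conjDiagonal hσ.posSemidef.isHermitian
  exact le_ciSup (isGreatest_resolventForm ht (conjDiagonal_nonneg_iff.1 hρ)
    (conjDiagonal_nonneg_iff.1 hσ)).bddAbove Z

theorem resolventSup_smul_add_smul_le (ht : 0 < t) {ρ₁ ρ₂ σ₁ σ₂ : Matrix n n ℂ} (hρ₁ : 0 ≤ ρ₁)
    (hρ₂ : 0 ≤ ρ₂) (hσ₁ : 0 ≤ σ₁) (hσ₂ : 0 ≤ σ₂) {a b : ℝ} (ha : 0 ≤ a) (hb : 0 ≤ b) :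
    resolventSup t (a • ρ₁ + b • ρ₂) (a • σ₁ + b • σ₂) ≤
      a * resolventSup t ρ₁ σ₁ + b * resolventSup t ρ₂ σ₂ := by
  refine ciSup_le fun Z => ?_
  rw [resolventForm_smul_add_smul]
  exact add_le_add
    (mul_le_mul_of_nonneg_left (resolventForm_le_resolventSup ht hρ₁ hσ₁ Z) ha)
    (mul_le_mul_of_nonneg_left (resolventForm_le_resolventSup ht hρ₂ hσ₂ Z) hb)

theorem resolventSup_anti (ht : 0 < t) (hρ : 0 ≤ ρ) (hσ : 0 ≤ σ) (hστ : σ ≤ τ) :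
    resolventSup t ρ τ ≤ resolventSup t ρ σ :=
  ciSup_le fun Z => (resolventForm_anti hστ Z).trans (resolventForm_le_resolventSup ht hρ hσ Z)

theorem resolvent_trace_le_resolventSup (ht : 0 < t) (hρ : 0 ≤ ρ) (hσ : 0 ≤ σ) :
    ρ.trace.re ^ 2 / (σ.trace.re + t * ρ.trace.re) ≤ resolventSup t ρ σ := by
  classical
  have hρtr : 0 ≤ ρ.trace.re := (Complex.nonneg_iff.1 hρ.posSemidef.trace_nonneg).1
  have hσtr : 0 ≤ σ.trace.re := (Complex.nonneg_iff.1 hσ.posSemidef.trace_nonneg).1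
  set z : ℝ := ρ.trace.re / (σ.trace.re + t * ρ.trace.re) with hz
  have hd : (σ.trace.re + t * ρ.trace.re) * z = ρ.trace.re := by
    refine mul_div_cancel_of_imp' fun h => ?_
    by_contra hne
    exact (by positivity : σ.trace.re + t * ρ.trace.re ≠ 0) h
  refine Eq.trans_le ?_ (resolventForm_le_resolventSup ht hρ hσ (z • 1))
  simp only [resolventForm, conjTranspose_smul, conjTranspose_one, Matrix.mul_smul,
    Matrix.smul_mul, Matrix.mul_one, Matrix.one_mul, trace_smul, Complex.smul_re, smul_eq_mul,
    star_trivial]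
  rw [pow_two, mul_div_assoc, ← hz]
  linear_combination z * hd

end ResolventForm

section RelativeEntropy

open MeasureTheory

variable {n : Type*} [Fintype n] [DecidableEq n] {ρ σ τ : Matrix n n ℂ}

/-- The quantum relative entropy `D(ρ‖σ) = tr ρ (log₂ ρ - log₂ σ)`. As `Real.logb 2 0 = 0`, this
real number is the relative entropy only when the kernel of `σ` is contained in the kernel
of `ρ`. -/
def relEntropy (ρ σ : Matrix n n ℂ) : ℝ :=
  (ρ * cfc (Real.logb 2) ρ).trace.re - (ρ * cfc (Real.logb 2) σ).trace.re

theorem trace_conjDiagonal_eq_sum_overlap (U V : unitaryGroup n ℂ) (p : n → ℝ) :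
    (conjDiagonal U p).trace.re = ∑ i, ∑ j, overlap U V i j * p i := by
  simp_rw [trace_conjDiagonal, ← Finset.sum_mul, sum_overlap, one_mul]

theorem relEntropy_conjDiagonal (U V : unitaryGroup n ℂ) (p q : n → ℝ) :
    relEntropy (conjDiagonal U p) (conjDiagonal V q) =
      ∑ i, ∑ j, overlap U V i j * (p i * (Real.logb 2 (p i) - Real.logb 2 (q j))) := by
  rw [relEntropy, cfc_map_pi, cfc_map_pi, ← map_mul, trace_conjDiagonal_eq_sum_overlap U V,
    trace_conjDiagonal_mul_conjDiagonal]
  simp only [← Finset.sum_sub_distrib, ← mul_sub, Pi.mul_apply, Function.comp_apply]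

theorem resolventSup_conjDiagonal_sub {t : ℝ} (ht : 0 < t) {U V : unitaryGroup n ℂ} {p q : n → ℝ}
    (hp : 0 ≤ p) (hq : 0 ≤ q) :
    resolventSup t (conjDiagonal U p) (conjDiagonal V q) - (conjDiagonal U p).trace.re / (1 + t) =
      ∑ i, ∑ j, overlap U V i j * (p i ^ 2 / (q j + t * p i) - p i / (1 + t)) := by
  rw [resolventSup_conjDiagonal ht hp hq, trace_conjDiagonal_eq_sum_overlap U V]
  simp only [Finset.sum_div, ← Finset.sum_sub_distrib]
  simp only [mul_sub, mul_div_assoc]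

theorem integrableOn_overlap_mul_resolvent_sub {U V : unitaryGroup n ℂ} {p q : n → ℝ}
    (h : IsDominated (conjDiagonal U p) (conjDiagonal V q)) (i j : n) :
    IntegrableOn (fun t => overlap U V i j * (p i ^ 2 / (q j + t * p i) - p i / (1 + t)))
      (Set.Ioi 0) := by
  have hp := conjDiagonal_nonneg_iff.1 h.left_nonneg
  have hq := conjDiagonal_nonneg_iff.1 h.right_nonneg
  rcases eq_or_ne (overlap U V i j) 0 with h0 | h0
  · simp [h0]
  · exact (integrableOn_resolvent_sub (hp i) (hq j) fun hj =>
      (mul_eq_zero_iff_left h0).1 (h.overlap_mul_eq_zero i hj)).const_mul _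

theorem integral_overlap_mul_resolvent_sub {U V : unitaryGroup n ℂ} {p q : n → ℝ}
    (h : IsDominated (conjDiagonal U p) (conjDiagonal V q)) (i j : n) :
    ∫ t in Set.Ioi 0, overlap U V i j * (p i ^ 2 / (q j + t * p i) - p i / (1 + t)) =
      overlap U V i j * (p i * (Real.log (p i) - Real.log (q j))) := by
  have hp := conjDiagonal_nonneg_iff.1 h.left_nonneg
  have hq := conjDiagonal_nonneg_iff.1 h.right_nonneg
  rcases eq_or_ne (overlap U V i j) 0 with h0 | h0
  · simp [h0]
  · rw [integral_const_mul, integral_resolvent_sub (hp i) (hq j) fun hj =>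
      (mul_eq_zero_iff_left h0).1 (h.overlap_mul_eq_zero i hj)]

omit [DecidableEq n] in
theorem integrableOn_resolventSup_sub (h : IsDominated ρ σ) :
    IntegrableOn (fun t => resolventSup t ρ σ - ρ.trace.re / (1 + t)) (Set.Ioi 0) := by
  classical
  obtain ⟨U, p, rfl⟩ := exists_eq_conjDiagonal h.left_nonneg.posSemidef.isHermitian
  obtain ⟨V, q, rfl⟩ := exists_eq_conjDiagonal h.right_nonneg.posSemidef.isHermitian
  refine IntegrableOn.congr_fun ?_ (fun t ht => (resolventSup_conjDiagonal_sub ht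
    (conjDiagonal_nonneg_iff.1 h.left_nonneg) (conjDiagonal_nonneg_iff.1 h.right_nonneg)).symm)
    measurableSet_Ioi
  exact integrable_finsetSum _ fun i _ => integrable_finsetSum _ fun j _ =>
    integrableOn_overlap_mul_resolvent_sub h i j

theorem integral_resolventSup_sub (h : IsDominated ρ σ) :
    ∫ t in Set.Ioi 0, (resolventSup t ρ σ - ρ.trace.re / (1 + t)) =
      relEntropy ρ σ * Real.log 2 := by
  obtain ⟨U, p, rfl⟩ := exists_eq_conjDiagonal h.left_nonneg.posSemidef.isHermitian
  obtain ⟨V, q, rfl⟩ := exists_eq_conjDiagonal h.right_nonneg.posSemidef.isHermitian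
  rw [setIntegral_congr_fun measurableSet_Ioi fun t ht =>
    resolventSup_conjDiagonal_sub ht (conjDiagonal_nonneg_iff.1 h.left_nonneg)
      (conjDiagonal_nonneg_iff.1 h.right_nonneg)]
  have integrable (i j : n) := integrableOn_overlap_mul_resolvent_sub h i j
  rw [integral_finsetSum _ fun i _ => integrable_finsetSum _ fun j _ => integrable i j]
  simp_rw [integral_finsetSum _ fun j _ => integrable _ j,
    integral_overlap_mul_resolvent_sub h, relEntropy_conjDiagonal, Finset.sum_mul, mul_assoc,
    sub_mul, Real.logb, div_mul_cancel₀ _ (Real.log_pos one_lt_two).ne']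

theorem relEntropy_smul_add_smul_le {ρ₁ ρ₂ σ₁ σ₂ : Matrix n n ℂ} (h₁ : IsDominated ρ₁ σ₁)
    (h₂ : IsDominated ρ₂ σ₂) {a b : ℝ} (ha : 0 ≤ a) (hb : 0 ≤ b) :
    relEntropy (a • ρ₁ + b • ρ₂) (a • σ₁ + b • σ₂) ≤
      a * relEntropy ρ₁ σ₁ + b * relEntropy ρ₂ σ₂ := by
  have h := h₁.smul_add_smul h₂ ha hb
  have int₁ := (integrableOn_resolventSup_sub h₁).const_mul a
  have int₂ := (integrableOn_resolventSup_sub h₂).const_mul b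
  refine le_of_mul_le_mul_right ?_ (Real.log_pos one_lt_two)
  rw [add_mul, mul_assoc, mul_assoc, ← integral_resolventSup_sub h, ← integral_resolventSup_sub h₁,
    ← integral_resolventSup_sub h₂, ← integral_const_mul, ← integral_const_mul,
    ← integral_add int₁ int₂]
  refine setIntegral_mono_on (integrableOn_resolventSup_sub h) (int₁.add int₂) measurableSet_Ioi
    fun t ht => ?_
  have := resolventSup_smul_add_smul_le ht h₁.left_nonneg h₂.left_nonneg h₁.right_nonneg
    h₂.right_nonneg ha hb
  simp only [trace_add, trace_smul, Complex.add_re, Complex.smul_re, smul_eq_mul, add_div]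
  linarith [mul_div_assoc a ρ₁.trace.re (1 + t), mul_div_assoc b ρ₂.trace.re (1 + t)]

theorem relEntropy_anti (h : IsDominated ρ σ) (hστ : σ ≤ τ) :
    relEntropy ρ τ ≤ relEntropy ρ σ := by
  have h' := h.mono_right hστ
  refine le_of_mul_le_mul_right ?_ (Real.log_pos one_lt_two)
  rw [← integral_resolventSup_sub h, ← integral_resolventSup_sub h']
  exact setIntegral_mono_on (integrableOn_resolventSup_sub h') (integrableOn_resolventSup_sub h)
    measurableSet_Ioi fun t ht =>
      sub_le_sub_right (resolventSup_anti ht h.left_nonneg h.right_nonneg hστ) _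

theorem trace_mul_logb_sub_logb_le_relEntropy (h : IsDominated ρ σ) :
    ρ.trace.re * (Real.logb 2 ρ.trace.re - Real.logb 2 σ.trace.re) ≤ relEntropy ρ σ := by
  have hρ := (Complex.nonneg_iff.1 h.left_nonneg.posSemidef.trace_nonneg).1
  have hσ := (Complex.nonneg_iff.1 h.right_nonneg.posSemidef.trace_nonneg).1
  refine le_of_mul_le_mul_right ?_ (Real.log_pos one_lt_two)
  calc ρ.trace.re * (Real.logb 2 ρ.trace.re - Real.logb 2 σ.trace.re) * Real.log 2
      = ρ.trace.re * (Real.log ρ.trace.re - Real.log σ.trace.re) := by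
        rw [mul_assoc, sub_mul, Real.logb, Real.logb,
          div_mul_cancel₀ _ (Real.log_pos one_lt_two).ne',
          div_mul_cancel₀ _ (Real.log_pos one_lt_two).ne']
    _ = ∫ t in Set.Ioi 0, (ρ.trace.re ^ 2 / (σ.trace.re + t * ρ.trace.re) -
          ρ.trace.re / (1 + t)) := (integral_resolvent_sub hρ hσ h.trace_eq_zero).symm
    _ ≤ ∫ t in Set.Ioi 0, (resolventSup t ρ σ - ρ.trace.re / (1 + t)) :=
        setIntegral_mono_on (integrableOn_resolvent_sub hρ hσ h.trace_eq_zero)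
          (integrableOn_resolventSup_sub h) measurableSet_Ioi fun t ht =>
            sub_le_sub_right
              (resolvent_trace_le_resolventSup ht h.left_nonneg h.right_nonneg) _
    _ = relEntropy ρ σ * Real.log 2 := integral_resolventSup_sub h

theorem relEntropy_self (ρ : Matrix n n ℂ) : relEntropy ρ ρ = 0 := sub_self _

theorem relEntropy_smul_right (h : IsDominated ρ σ) {c : ℝ} (hc : c ≠ 0) :
    relEntropy ρ (c • σ) = relEntropy ρ σ - ρ.trace.re * Real.logb 2 c := by
  obtain ⟨U, p, rfl⟩ := exists_eq_conjDiagonal h.left_nonneg.posSemidef.isHermitian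
  obtain ⟨V, q, rfl⟩ := exists_eq_conjDiagonal h.right_nonneg.posSemidef.isHermitian
  rw [← map_smul, relEntropy_conjDiagonal, relEntropy_conjDiagonal,
    trace_conjDiagonal_eq_sum_overlap U V]
  simp only [Finset.sum_mul, ← Finset.sum_sub_distrib, Pi.smul_apply, smul_eq_mul]
  refine Finset.sum_congr rfl fun i _ => Finset.sum_congr rfl fun j _ => ?_
  rcases eq_or_ne (q j) 0 with hj | hj
  · simp only [← mul_assoc, h.overlap_mul_eq_zero i hj, zero_mul, sub_zero]
  · rw [Real.logb_mul hc hj]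
    ring

theorem relEntropy_le_of_le_smul (hρ : 0 ≤ ρ) {c : ℝ} (hc : 0 < c) (h : ρ ≤ c • σ) :
    relEntropy ρ σ ≤ ρ.trace.re * Real.logb 2 c := by
  have hσ : 0 ≤ σ := by
    simpa [smul_smul, hc.ne'] using smul_nonneg (inv_nonneg.2 hc.le) (hρ.trans h)
  have := relEntropy_anti (IsDominated.refl hρ) h
  rw [relEntropy_self, relEntropy_smul_right ⟨hρ, hσ, c, hc.le, h⟩ hc.ne'] at this
  linarith

end RelativeEntropy

section States

variable {n : Type*} [Fintype n]

theorem le_trace_smul_one [DecidableEq n] {ρ : Matrix n n ℂ} (hρ : 0 ≤ ρ) : ρ ≤ ρ.trace.re • 1 := by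
  obtain ⟨U, p, rfl⟩ := exists_eq_conjDiagonal hρ.posSemidef.isHermitian
  have hp := conjDiagonal_nonneg_iff.1 hρ
  rw [trace_conjDiagonal, ← sub_nonneg, ← map_one (conjDiagonal U), ← map_smul, ← map_sub,
    conjDiagonal_nonneg_iff]
  intro i
  simpa using Finset.single_le_sum (fun j _ => hp j) (Finset.mem_univ i)

theorem isState_of_nonneg {ρ : Matrix n n ℂ} (hρ : 0 ≤ ρ) (htr : ρ.trace.re = 1) : IsState ρ :=
  ⟨hρ.posSemidef, Complex.ext htr (Complex.nonneg_iff.1 hρ.posSemidef.trace_nonneg).2.symm⟩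

theorem convex_setOf_isState : Convex ℝ {ρ : Matrix n n ℂ | IsState ρ} := by
  intro ρ hρ σ hσ a b ha hb hab
  refine ⟨(hρ.1.smul ha).add (hσ.1.smul hb), ?_⟩
  rw [trace_add, trace_smul, trace_smul, hρ.2, hσ.2, ← add_smul, hab, one_smul]

namespace IsState

variable {ρ : Matrix n n ℂ} (hρ : IsState ρ)
include hρ

theorem nonneg : 0 ≤ ρ := nonneg_iff_posSemidef.2 hρ.1

theorem trace_re : ρ.trace.re = 1 := by rw [hρ.2, Complex.one_re]

theorem card_pos : 0 < Fintype.card n := by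
  refine Fintype.card_pos_iff.2 (not_isEmpty_iff.1 fun _ => zero_ne_one (α := ℂ) ?_)
  rw [← hρ.2, trace_eq_zero_of_isEmpty]

variable [DecidableEq n]

theorem le_one : ρ ≤ 1 := by
  simpa only [hρ.trace_re, one_smul] using le_trace_smul_one hρ.nonneg

theorem isDominated_one : IsDominated ρ 1 :=
  ⟨hρ.nonneg, zero_le_one, 1, zero_le_one, by rw [one_smul]; exact hρ.le_one⟩

end IsState

end States

section Entropy

variable {n : Type*} [Fintype n] [DecidableEq n] {ρ σ : Matrix n n ℂ}

/-- A concave functional on states whose defect from affinity on the segment from `ρ` to `σ` is at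
most the binary entropy of the weights. These are the functionals to which the
Alicki–Fannes–Winter continuity argument applies. -/
structure IsAlmostAffine (F : Matrix n n ℂ → ℝ) : Prop where
  concaveOn : ConcaveOn ℝ {ρ | IsState ρ} F
  le_add_binaryEntropy {ρ σ : Matrix n n ℂ} (hρ : IsState ρ) (hσ : IsState σ) {a b : ℝ}
    (ha : 0 ≤ a) (hb : 0 ≤ b) (hab : a + b = 1) :
    F (a • ρ + b • σ) ≤ a * F ρ + b * F σ + binaryEntropy b

theorem relEntropy_one_right (ρ : Matrix n n ℂ) : relEntropy ρ 1 = -entropy ρ := by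
  rw [relEntropy, entropy, neg_neg, ← map_one (conjDiagonal 1), cfc_map_pi]
  have : Real.logb 2 ∘ (1 : n → ℝ) = 0 := by ext i; simp
  rw [this, map_zero, Matrix.mul_zero, trace_zero, Complex.zero_re, sub_zero]

theorem entropy_nonneg (hρ : IsState ρ) : 0 ≤ entropy ρ := by
  have := relEntropy_le_of_le_smul (σ := 1) hρ.nonneg one_pos (by rw [one_smul]; exact hρ.le_one)
  rwa [relEntropy_one_right, Real.logb_one, mul_zero, neg_nonpos] at this

theorem entropy_le_logb_card (hρ : IsState ρ) : entropy ρ ≤ Real.logb 2 (Fintype.card n) := by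
  have := trace_mul_logb_sub_logb_le_relEntropy hρ.isDominated_one
  rw [relEntropy_one_right, hρ.trace_re, trace_one, Complex.natCast_re, Real.logb_one] at this
  linarith

theorem concaveOn_entropy : ConcaveOn ℝ {ρ : Matrix n n ℂ | IsState ρ} entropy := by
  refine ⟨convex_setOf_isState, fun ρ hρ σ hσ a b ha hb hab => ?_⟩
  have := relEntropy_smul_add_smul_le hρ.isDominated_one hσ.isDominated_one ha hb
  rw [← add_smul, hab, one_smul] at this
  simp only [relEntropy_one_right] at this
  simp only [smul_eq_mul]
  linarith

theorem entropy_smul_add_smul (a b : ℝ) (ρ σ : Matrix n n ℂ) :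
    entropy (a • ρ + b • σ) = a * entropy ρ + b * entropy σ +
      (a * relEntropy ρ (a • ρ + b • σ) + b * relEntropy σ (a • ρ + b • σ)) := by
  simp only [entropy, relEntropy]
  generalize cfc (Real.logb 2) (a • ρ + b • σ) = L
  simp only [Matrix.add_mul, Matrix.smul_mul, trace_add, trace_smul, Complex.add_re,
    Complex.smul_re, smul_eq_mul]
  ring

theorem mul_relEntropy_smul_add_le (hρ : IsState ρ) {τ : Matrix n n ℂ} (hτ : 0 ≤ τ) {a : ℝ}
    (ha : 0 ≤ a) : a * relEntropy ρ (a • ρ + τ) ≤ -a * Real.logb 2 a := by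
  rcases ha.eq_or_lt with rfl | ha
  · simp
  have hle : ρ ≤ a⁻¹ • (a • ρ + τ) := by
    rw [smul_add, smul_smul, inv_mul_cancel₀ ha.ne', one_smul]
    exact le_add_of_nonneg_right (smul_nonneg (inv_nonneg.2 ha.le) hτ)
  have := relEntropy_le_of_le_smul hρ.nonneg (inv_pos.2 ha) hle
  rw [hρ.trace_re, one_mul, Real.logb_inv] at this
  linarith [mul_le_mul_of_nonneg_left this ha.le]

theorem isAlmostAffine_entropy : IsAlmostAffine (entropy (n := n)) where
  concaveOn := concaveOn_entropy
  le_add_binaryEntropy {ρ σ} hρ hσ {a b} ha hb hab := by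
    have left := mul_relEntropy_smul_add_le hρ (smul_nonneg hb hσ.nonneg) ha
    have right := mul_relEntropy_smul_add_le hσ (smul_nonneg ha hρ.nonneg) hb
    rw [add_comm (b • σ)] at right
    rw [entropy_smul_add_smul, binaryEntropy, ← hab, add_sub_cancel_right]
    linarith

end Entropy

section Bipartite

theorem sum_mul_mul_conjTranspose_sum_le {ι m n : Type*} [Fintype ι] [Finite m] [Fintype n]
    {ρ : Matrix n n ℂ} (hρ : 0 ≤ ρ) (X : ι → Matrix m n ℂ) :
    (∑ a, X a) * ρ * (∑ a, X a)ᴴ ≤ (Fintype.card ι : ℝ) • ∑ a, X a * ρ * (X a)ᴴ := by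
  have := Fintype.ofFinite m
  have sum_sub_nonneg : 0 ≤ ∑ a, ∑ b, (X a - X b) * ρ * (X a - X b)ᴴ :=
    Finset.sum_nonneg fun a _ => Finset.sum_nonneg fun b _ =>
      (hρ.posSemidef.mul_mul_conjTranspose_same _).nonneg
  have sum_sub_eq : ∑ a, ∑ b, (X a - X b) * ρ * (X a - X b)ᴴ =
      (2 : ℝ) • ((Fintype.card ι : ℝ) • ∑ a, X a * ρ * (X a)ᴴ -
        (∑ a, X a) * ρ * (∑ a, X a)ᴴ) := by
    simp only [conjTranspose_sub, conjTranspose_sum, Matrix.sub_mul, Matrix.mul_sub,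
      Matrix.sum_mul, Matrix.mul_sum, Finset.sum_sub_distrib, Finset.sum_const, Finset.card_univ]
    rw [Finset.sum_comm (f := fun a b => X b * ρ * (X a)ᴴ)]
    simp only [← Nat.cast_smul_eq_nsmul ℝ, ← Finset.smul_sum]
    module
  rw [sum_sub_eq] at sum_sub_nonneg
  exact sub_nonneg.1 (nonneg_of_smul_nonneg_of_pos_left sum_sub_nonneg two_pos)

theorem sum_single_kronecker_one {A B : Type*} [Fintype A] [DecidableEq A] [DecidableEq B] :
    ∑ a : A, single a a 1 ⊗ₖ (1 : Matrix B B ℂ) = 1 := by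
  have := map_sum ((kroneckerBilinear (R := ℂ)).flip (1 : Matrix B B ℂ))
    (fun a : A => single a a 1) Finset.univ
  rw [sum_single_one] at this
  exact this.symm.trans one_kronecker_one

variable {A B : Type*}

section ReducedA

variable [Fintype B] (ρ σ : Matrix (A × B) (A × B) ℂ)

theorem reducedA_eq_sum_submatrix :
    reducedA ρ = ∑ b, ρ.submatrix (fun a => (a, b)) fun a => (a, b) := by
  ext i j
  simp [reducedA, Matrix.sum_apply]

theorem reducedA_smul_add_smul (s t : ℝ) :
    reducedA (s • ρ + t • σ) = s • reducedA ρ + t • reducedA σ := by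
  simp only [reducedA_eq_sum_submatrix, submatrix_add, submatrix_smul, Pi.add_apply, Pi.smul_apply,
    Finset.sum_add_distrib, Finset.smul_sum]

theorem trace_reducedA [Fintype A] : (reducedA ρ).trace = ρ.trace := by
  simp only [trace, reducedA, diag_apply, of_apply, Fintype.sum_prod_type]

end ReducedA

section ReducedB

variable [Fintype A] (ρ σ : Matrix (A × B) (A × B) ℂ)

theorem reducedB_eq_sum_submatrix :
    reducedB ρ = ∑ a, ρ.submatrix (Prod.mk a) (Prod.mk a) := by
  ext i j
  simp [reducedB, Matrix.sum_apply]

theorem reducedB_smul_add_smul (s t : ℝ) :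
    reducedB (s • ρ + t • σ) = s • reducedB ρ + t • reducedB σ := by
  simp only [reducedB_eq_sum_submatrix, submatrix_add, submatrix_smul, Pi.add_apply, Pi.smul_apply,
    Finset.sum_add_distrib, Finset.smul_sum]

theorem trace_reducedB [Fintype B] : (reducedB ρ).trace = ρ.trace := by
  simp only [trace, reducedB, diag_apply, of_apply, Fintype.sum_prod_type_right]

variable {ρ} in
theorem reducedB_nonneg (hρ : 0 ≤ ρ) : 0 ≤ reducedB ρ := by
  rw [reducedB_eq_sum_submatrix]
  exact Finset.sum_nonneg fun a _ => (hρ.posSemidef.submatrix _).nonneg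

end ReducedB

section OneKronecker

variable [Fintype A] [DecidableEq A] {ρ : Matrix (A × B) (A × B) ℂ}

theorem single_kronecker_one_mul_mul_conjTranspose [Fintype B] [DecidableEq B]
    (ρ : Matrix (A × B) (A × B) ℂ) (a a' : A) :
    (single a a' 1 ⊗ₖ (1 : Matrix B B ℂ)) * ρ * (single a a' 1 ⊗ₖ (1 : Matrix B B ℂ))ᴴ =
      single a a 1 ⊗ₖ ρ.submatrix (Prod.mk a') (Prod.mk a') := by
  rw [conjTranspose_kronecker, conjTranspose_single, conjTranspose_one, star_one]
  ext ⟨i, b⟩ ⟨j, b'⟩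
  by_cases hi : a = i <;> by_cases hj : a = j <;>
    simp [mul_apply, Fintype.sum_prod_type, single_apply, one_apply, hi, hj, ite_and]

theorem sum_sum_single_kronecker_one_mul_mul_conjTranspose [Fintype B] [DecidableEq B]
    (ρ : Matrix (A × B) (A × B) ℂ) :
    ∑ a, ∑ a', (single a a' 1 ⊗ₖ (1 : Matrix B B ℂ)) * ρ *
      (single a a' 1 ⊗ₖ (1 : Matrix B B ℂ))ᴴ = (1 : Matrix A A ℂ) ⊗ₖ reducedB ρ := by
  simp only [single_kronecker_one_mul_mul_conjTranspose]
  ext ⟨i, b⟩ ⟨j, b'⟩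
  simp [Matrix.sum_apply, single_apply, one_apply, reducedB, ite_and]

theorem le_card_smul_one_kronecker_reducedB [Finite B] (hρ : 0 ≤ ρ) :
    ρ ≤ (Fintype.card A : ℝ) • (1 : Matrix A A ℂ) ⊗ₖ reducedB ρ := by
  classical
  have := Fintype.ofFinite B
  let E (a a' : A) : Matrix (A × B) (A × B) ℂ := single a a' 1 ⊗ₖ 1
  have E_mul_mul_nonneg (a a' : A) : 0 ≤ E a a' * ρ * (E a a')ᴴ :=
    (hρ.posSemidef.mul_mul_conjTranspose_same _).nonneg
  calc ρ = (∑ a, E a a) * ρ * (∑ a, E a a)ᴴ := by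
        rw [sum_single_kronecker_one, conjTranspose_one, Matrix.one_mul, Matrix.mul_one]
    _ ≤ (Fintype.card A : ℝ) • ∑ a, E a a * ρ * (E a a)ᴴ :=
        sum_mul_mul_conjTranspose_sum_le hρ fun a => E a a
    _ ≤ (Fintype.card A : ℝ) • ∑ a, ∑ a', E a a' * ρ * (E a a')ᴴ := by
        refine smul_le_smul_of_nonneg_left (Finset.sum_le_sum fun a _ => ?_) (Nat.cast_nonneg _)
        exact Finset.single_le_sum (fun a' _ => E_mul_mul_nonneg a a') (Finset.mem_univ a)
    _ = (Fintype.card A : ℝ) • (1 : Matrix A A ℂ) ⊗ₖ reducedB ρ := by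
        rw [sum_sum_single_kronecker_one_mul_mul_conjTranspose]

theorem isDominated_one_kronecker_reducedB [Finite B] (hρ : 0 ≤ ρ) :
    IsDominated ρ ((1 : Matrix A A ℂ) ⊗ₖ reducedB ρ) :=
  have := Fintype.ofFinite B
  ⟨hρ, (PosSemidef.one.kronecker (reducedB_nonneg hρ).posSemidef).nonneg, Fintype.card A,
    Nat.cast_nonneg _, le_card_smul_one_kronecker_reducedB hρ⟩

end OneKronecker

variable [Fintype A] [Fintype B] {ρ : Matrix (A × B) (A × B) ℂ}

theorem IsState.reducedA (hρ : IsState ρ) : IsState (reducedA ρ) := by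
  refine ⟨?_, (trace_reducedA ρ).trans hρ.2⟩
  rw [reducedA_eq_sum_submatrix]
  exact posSemidef_sum _ fun b _ => hρ.1.submatrix _

theorem IsState.reducedB (hρ : IsState ρ) : IsState (reducedB ρ) :=
  ⟨(reducedB_nonneg hρ.nonneg).posSemidef, (trace_reducedB ρ).trans hρ.2⟩

variable [DecidableEq A]

theorem isAlmostAffine_entropy_reducedA :
    IsAlmostAffine fun ρ : Matrix (A × B) (A × B) ℂ => entropy (reducedA ρ) where
  concaveOn := by
    refine ⟨convex_setOf_isState, fun ρ hρ σ hσ a b ha hb hab => ?_⟩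
    simp only [reducedA_smul_add_smul]
    exact concaveOn_entropy.2 hρ.reducedA hσ.reducedA ha hb hab
  le_add_binaryEntropy {ρ σ} hρ hσ {a b} ha hb hab := by
    rw [reducedA_smul_add_smul]
    exact isAlmostAffine_entropy.le_add_binaryEntropy hρ.reducedA hσ.reducedA ha hb hab

theorem trace_mul_one_kronecker (ρ : Matrix (A × B) (A × B) ℂ) (M : Matrix B B ℂ) :
    (ρ * (1 : Matrix A A ℂ) ⊗ₖ M).trace = (reducedB ρ * M).trace := by
  simp only [trace, reducedB, diag_apply, of_apply, mul_apply, Fintype.sum_prod_type_right,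
    kronecker_apply, one_apply, ite_mul, one_mul, zero_mul, mul_ite, mul_zero, Finset.sum_ite_eq',
    Finset.mem_univ, if_true, Finset.sum_mul]
  exact Finset.sum_congr rfl fun b _ => Finset.sum_comm

variable [DecidableEq B]

theorem cfc_one_kronecker {M : Matrix B B ℂ} (hM : M.IsHermitian) (f : ℝ → ℝ) :
    cfc f ((1 : Matrix A A ℂ) ⊗ₖ M) = (1 : Matrix A A ℂ) ⊗ₖ cfc f M := by
  obtain ⟨U, p, rfl⟩ := exists_eq_conjDiagonal hM
  obtain ⟨W, hW⟩ := kronecker_conjDiagonal (1 : unitaryGroup A ℂ) U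
  rw [cfc_map_pi, ← map_one (conjDiagonal (1 : unitaryGroup A ℂ)), hW, hW, cfc_map_pi]
  simp [Function.comp_def]

end Bipartite

section ConditionalEntropy

variable {A B : Type*} [Fintype A] [DecidableEq A] [Fintype B] [DecidableEq B]
  {ρ : Matrix (A × B) (A × B) ℂ}

/-- The conditional entropy `S(A|B) = S(AB) - S(B)`. -/
def condEntropy (ρ : Matrix (A × B) (A × B) ℂ) : ℝ := entropy ρ - entropy (reducedB ρ)

theorem condEntropy_eq_neg_relEntropy (hρ : 0 ≤ ρ) :
    condEntropy ρ = -relEntropy ρ ((1 : Matrix A A ℂ) ⊗ₖ reducedB ρ) := by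
  rw [relEntropy, cfc_one_kronecker (reducedB_nonneg hρ).posSemidef.isHermitian,
    trace_mul_one_kronecker, condEntropy, entropy, entropy]
  ring

theorem neg_logb_card_le_condEntropy (hρ : IsState ρ) :
    -Real.logb 2 (Fintype.card A) ≤ condEntropy ρ := by
  have := relEntropy_le_of_le_smul hρ.nonneg (Nat.cast_pos.2 hρ.reducedA.card_pos)
    (le_card_smul_one_kronecker_reducedB hρ.nonneg)
  rw [hρ.trace_re, one_mul] at this
  rw [condEntropy_eq_neg_relEntropy hρ.nonneg]
  exact neg_le_neg this

theorem condEntropy_le_logb_card (hρ : IsState ρ) :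
    condEntropy ρ ≤ Real.logb 2 (Fintype.card A) := by
  have := trace_mul_logb_sub_logb_le_relEntropy (isDominated_one_kronecker_reducedB hρ.nonneg)
  rw [hρ.trace_re, trace_kronecker, hρ.reducedB.2, trace_one, mul_one, Complex.natCast_re,
    Real.logb_one] at this
  rw [condEntropy_eq_neg_relEntropy hρ.nonneg]
  linarith

theorem concaveOn_condEntropy :
    ConcaveOn ℝ {ρ : Matrix (A × B) (A × B) ℂ | IsState ρ} condEntropy := by
  refine ⟨convex_setOf_isState, fun ρ hρ σ hσ a b ha hb hab => ?_⟩
  have := relEntropy_smul_add_smul_le (isDominated_one_kronecker_reducedB hρ.nonneg)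
    (isDominated_one_kronecker_reducedB hσ.nonneg) ha hb
  simp only [smul_eq_mul]
  rw [condEntropy_eq_neg_relEntropy hρ.nonneg, condEntropy_eq_neg_relEntropy hσ.nonneg,
    condEntropy_eq_neg_relEntropy (convex_setOf_isState hρ hσ ha hb hab).nonneg,
    reducedB_smul_add_smul, kronecker_add, kronecker_smul, kronecker_smul]
  linarith

theorem isAlmostAffine_condEntropy : IsAlmostAffine (condEntropy (A := A) (B := B)) where
  concaveOn := concaveOn_condEntropy
  le_add_binaryEntropy {ρ σ} hρ hσ {a b} ha hb hab := by
    have joint := isAlmostAffine_entropy.le_add_binaryEntropy hρ hσ ha hb hab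
    have reduced := concaveOn_entropy.2 hρ.reducedB hσ.reducedB ha hb hab
    simp only [smul_eq_mul] at reduced
    rw [condEntropy, condEntropy, condEntropy, reducedB_smul_add_smul]
    linarith

theorem mutualInfo_eq_entropy_sub_condEntropy (ρ : Matrix (A × B) (A × B) ℂ) :
    mutualInfo ρ = entropy (reducedA ρ) - condEntropy ρ := by
  rw [mutualInfo, condEntropy]
  ring

end ConditionalEntropy

section JordanDecomposition

variable {n : Type*} [Fintype n] [DecidableEq n] {X ρ σ : Matrix n n ℂ}

theorem traceNorm_nonneg (hX : X.IsHermitian) : 0 ≤ traceNorm X := by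
  obtain ⟨U, p, rfl⟩ := exists_eq_conjDiagonal hX
  rw [traceNorm_conjDiagonal]
  exact Finset.sum_nonneg fun i _ => abs_nonneg _

theorem eq_zero_of_traceNorm_eq_zero (hX : X.IsHermitian) (h : traceNorm X = 0) : X = 0 := by
  obtain ⟨U, p, rfl⟩ := exists_eq_conjDiagonal hX
  rw [traceNorm_conjDiagonal, Finset.sum_eq_zero_iff_of_nonneg fun i _ => abs_nonneg _] at h
  have hp : p = 0 := funext fun i => abs_eq_zero.1 (h i (Finset.mem_univ i))
  rw [hp, map_zero]

theorem exists_nonneg_sub_eq_of_trace_eq_zero (hX : X.IsHermitian) (htr : X.trace = 0) :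
    ∃ P N, 0 ≤ P ∧ 0 ≤ N ∧ P.trace.re = traceNorm X / 2 ∧ N.trace.re = traceNorm X / 2 ∧
      P - N = X := by
  obtain ⟨U, p, rfl⟩ := exists_eq_conjDiagonal hX
  have hsum : ∑ i, p i = 0 := by rw [← trace_conjDiagonal U, htr, Complex.zero_re]
  have sub_eq : ∑ i, (p i)⁺ - ∑ i, (p i)⁻ = 0 := by
    simp only [← Finset.sum_sub_distrib, posPart_sub_negPart, hsum]
  have add_eq : ∑ i, (p i)⁺ + ∑ i, (p i)⁻ = ∑ i, |p i| := by
    simp only [← Finset.sum_add_distrib, posPart_add_negPart]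
  refine ⟨conjDiagonal U p⁺, conjDiagonal U p⁻, conjDiagonal_nonneg_iff.2 (posPart_nonneg p),
    conjDiagonal_nonneg_iff.2 (negPart_nonneg p), ?_, ?_, ?_⟩
  · rw [trace_conjDiagonal, traceNorm_conjDiagonal]
    simp only [Pi.posPart_apply]
    linarith
  · rw [trace_conjDiagonal, traceNorm_conjDiagonal]
    simp only [Pi.negPart_apply]
    linarith
  · rw [← map_sub, posPart_sub_negPart]

omit [DecidableEq n] in
theorem isState_inv_smul (hX : 0 ≤ X) (htr : X.trace.re ≠ 0) : IsState (X.trace.re⁻¹ • X) := by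
  have := (Complex.nonneg_iff.1 hX.posSemidef.trace_nonneg).1
  refine isState_of_nonneg (smul_nonneg (inv_nonneg.2 this) hX) ?_
  rw [trace_smul, Complex.smul_re, smul_eq_mul, inv_mul_cancel₀ htr]

theorem exists_isState_add_smul_eq (hρ : IsState ρ) (hσ : IsState σ) :
    ∃ P N, IsState P ∧ IsState N ∧
      ρ + (traceNorm (ρ - σ) / 2) • N = σ + (traceNorm (ρ - σ) / 2) • P := by
  have hermitian := hρ.1.isHermitian.sub hσ.1.isHermitian
  rcases eq_or_ne (traceNorm (ρ - σ)) 0 with h0 | h0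
  · refine ⟨ρ, ρ, hρ, hρ, ?_⟩
    rw [sub_eq_zero.1 (eq_zero_of_traceNorm_eq_zero hermitian h0)]
  · obtain ⟨P, N, hP, hN, hPtr, hNtr, hPN⟩ := exists_nonneg_sub_eq_of_trace_eq_zero hermitian
      (by rw [trace_sub, hρ.2, hσ.2, sub_self])
    have half_ne : traceNorm (ρ - σ) / 2 ≠ 0 := div_ne_zero h0 two_ne_zero
    refine ⟨_, _, isState_inv_smul hP (hPtr ▸ half_ne), isState_inv_smul hN (hNtr ▸ half_ne), ?_⟩
    rw [hPtr, hNtr, smul_inv_smul₀ half_ne, smul_inv_smul₀ half_ne, add_comm σ,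
      ← sub_eq_sub_iff_add_eq_add, hPN]

end JordanDecomposition

section Continuity

namespace IsAlmostAffine

variable {n : Type*} [Fintype n] {ρ σ P N : Matrix n n ℂ} {F : Matrix n n ℂ → ℝ} {m M : ℝ}
  (hF : IsAlmostAffine F) (hm : ∀ ρ, IsState ρ → m ≤ F ρ) (hM : ∀ ρ, IsState ρ → F ρ ≤ M)
include hF hm hM

theorem sub_le_of_add_smul_eq (hρ : IsState ρ) (hσ : IsState σ) (hP : IsState P) (hN : IsState N)
    {ε : ℝ} (hε : 0 ≤ ε) (h : ρ + ε • N = σ + ε • P) :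
    F ρ - F σ ≤ ε * (M - m) + (1 + ε) * binaryEntropy (ε / (1 + ε)) := by
  have hpos : 0 < 1 + ε := by linarith
  have ha : 0 ≤ (1 + ε)⁻¹ := (inv_pos.2 hpos).le
  have hb : 0 ≤ ε / (1 + ε) := div_nonneg hε hpos.le
  have hab : (1 + ε)⁻¹ + ε / (1 + ε) = 1 := by field_simp
  have mixtures_eq :
      (1 + ε)⁻¹ • ρ + (ε / (1 + ε)) • N = (1 + ε)⁻¹ • σ + (ε / (1 + ε)) • P := by
    simpa only [smul_add, smul_smul, div_eq_inv_mul] using congrArg ((1 + ε)⁻¹ • ·) h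
  have lower := hF.concaveOn.2 hρ hN ha hb hab
  have upper := hF.le_add_binaryEntropy hσ hP ha hb hab
  rw [mixtures_eq] at lower
  have scaled := mul_le_mul_of_nonneg_left (lower.trans upper) hpos.le
  have scaled_lower : (1 + ε) * ((1 + ε)⁻¹ • F ρ + (ε / (1 + ε)) • F N) = F ρ + ε * F N := by
    simp only [smul_eq_mul]
    field_simp
  have scaled_upper :
      (1 + ε) * ((1 + ε)⁻¹ * F σ + ε / (1 + ε) * F P + binaryEntropy (ε / (1 + ε))) =
        F σ + ε * F P + (1 + ε) * binaryEntropy (ε / (1 + ε)) := by field_simp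
  rw [scaled_lower, scaled_upper] at scaled
  linarith [mul_le_mul_of_nonneg_left (hm N hN) hε, mul_le_mul_of_nonneg_left (hM P hP) hε]

theorem abs_sub_le [DecidableEq n] (hρ : IsState ρ) (hσ : IsState σ) {ε : ℝ}
    (hε : ε = traceNorm (ρ - σ) / 2) :
    |F ρ - F σ| ≤ ε * (M - m) + (1 + ε) * binaryEntropy (ε / (1 + ε)) := by
  have hε0 : 0 ≤ ε :=
    hε ▸ div_nonneg (traceNorm_nonneg (hρ.1.isHermitian.sub hσ.1.isHermitian)) zero_le_two
  obtain ⟨P, N, hP, hN, h⟩ := exists_isState_add_smul_eq hρ hσ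
  rw [← hε] at h
  exact abs_sub_le_iff.2 ⟨hF.sub_le_of_add_smul_eq hm hM hρ hσ hP hN hε0 h,
    hF.sub_le_of_add_smul_eq hm hM hσ hρ hN hP hε0 h.symm⟩

end IsAlmostAffine

end Continuity
section BinaryEntropy

theorem binaryEntropy_mul_log_two (x : ℝ) : binaryEntropy x * Real.log 2 = Real.binEntropy x := by
  have : Real.log 2 ≠ 0 := (Real.log_pos one_lt_two).ne'
  simp only [binaryEntropy, Real.binEntropy, Real.logb, Real.log_inv]
  field_simp
  ring

theorem binaryEntropy_nonneg {x : ℝ} (h0 : 0 ≤ x) (h1 : x ≤ 1) : 0 ≤ binaryEntropy x :=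
  nonneg_of_mul_nonneg_left
    (binaryEntropy_mul_log_two x ▸ Real.binEntropy_nonneg h0 h1) (Real.log_pos one_lt_two)

theorem neg_mul_log_le_binEntropy {x : ℝ} (h0 : 0 ≤ x) (h1 : x ≤ 1) :
    -(x * Real.log x) ≤ Real.binEntropy x := by
  have := mul_nonneg (sub_nonneg.2 h1)
    (neg_nonneg.2 (Real.log_nonpos (sub_nonneg.2 h1) (sub_le_self 1 h0)))
  rw [Real.binEntropy, Real.log_inv, Real.log_inv]
  linarith

theorem one_add_mul_binEntropy {ε : ℝ} (hε : 0 ≤ ε) :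
    (1 + ε) * Real.binEntropy (ε / (1 + ε)) = (1 + ε) * Real.log (1 + ε) - ε * Real.log ε := by
  have hpos : 0 < 1 + ε := by linarith
  rcases hε.eq_or_lt with rfl | hε
  · simp
  rw [Real.binEntropy, show 1 - ε / (1 + ε) = (1 + ε)⁻¹ by field_simp; ring, inv_inv, inv_div,
    Real.log_div hpos.ne' hε.ne']
  field_simp
  ring

theorem one_add_mul_binaryEntropy_le {ε : ℝ} (hε : 0 ≤ ε) (hε' : ε ≤ 1 / 2) :
    (1 + ε) * binaryEntropy (ε / (1 + ε)) ≤ binaryEntropy (2 * ε) / 2 + 4 * ε := by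
  have log_le : Real.log (1 + ε) ≤ ε := by
    linarith [Real.log_le_sub_one_of_pos (show 0 < 1 + ε by linarith)]
  have log_two_lower : 0.69 < Real.log 2 := by linarith [Real.log_two_gt_d9]
  have neg_mul_log_le : -(ε * Real.log ε) ≤ Real.binEntropy (2 * ε) / 2 + ε * Real.log 2 := by
    rcases hε.eq_or_lt with rfl | hε
    · simp
    have := neg_mul_log_le_binEntropy (x := 2 * ε) (by linarith) (by linarith)
    rw [Real.log_mul two_ne_zero hε.ne'] at this
    linarith
  refine le_of_mul_le_mul_right ?_ (Real.log_pos one_lt_two)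
  calc (1 + ε) * binaryEntropy (ε / (1 + ε)) * Real.log 2
      = (1 + ε) * Real.log (1 + ε) - ε * Real.log ε := by
        rw [mul_assoc, binaryEntropy_mul_log_two, one_add_mul_binEntropy hε]
    _ ≤ 3 / 2 * ε + (Real.binEntropy (2 * ε) / 2 + ε * Real.log 2) := by nlinarith
    _ ≤ Real.binEntropy (2 * ε) / 2 + 4 * ε * Real.log 2 := by nlinarith
    _ = (binaryEntropy (2 * ε) / 2 + 4 * ε) * Real.log 2 := by
        rw [← binaryEntropy_mul_log_two]
        ring

end BinaryEntropy

section MutualInformation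

theorem isState_kronecker {A B : Type*} [Fintype A] [Fintype B] {ρ : Matrix A A ℂ}
    {σ : Matrix B B ℂ} (hρ : IsState ρ) (hσ : IsState σ) : IsState (ρ ⊗ₖ σ) :=
  ⟨hρ.1.kronecker hσ.1, by rw [trace_kronecker, hρ.2, hσ.2, one_mul]⟩

variable {A B : Type*} [Fintype A] [DecidableEq A] [Fintype B] [DecidableEq B]

theorem entropy_kronecker {ρ : Matrix A A ℂ} {σ : Matrix B B ℂ} (hρ : ρ.IsHermitian)
    (hσ : σ.IsHermitian) :
    entropy (ρ ⊗ₖ σ) = entropy ρ * σ.trace.re + ρ.trace.re * entropy σ := by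
  obtain ⟨U, p, rfl⟩ := exists_eq_conjDiagonal hρ
  obtain ⟨V, q, rfl⟩ := exists_eq_conjDiagonal hσ
  obtain ⟨W, hW⟩ := kronecker_conjDiagonal U V
  have mul_logb_mul (x y : ℝ) : x * y * Real.logb 2 (x * y) =
      x * Real.logb 2 x * y + x * (y * Real.logb 2 y) := by
    rcases eq_or_ne x 0 with rfl | hx
    · simp
    rcases eq_or_ne y 0 with rfl | hy
    · simp
    rw [Real.logb_mul hx hy]
    ring
  rw [hW]
  simp only [entropy_conjDiagonal, trace_conjDiagonal, Fintype.sum_prod_type, mul_logb_mul,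
    Finset.sum_add_distrib, ← Finset.mul_sum, ← Finset.sum_mul]
  ring

variable {ρ σ : Matrix (A × B) (A × B) ℂ}

theorem mutualInfo_productOfReduced (hρ : IsState ρ) : mutualInfo (productOfReduced ρ) = 0 := by
  rw [mutualInfo, productOfReduced, reducedA_kronecker, reducedB_kronecker, hρ.reducedA.2,
    hρ.reducedB.2, one_smul, one_smul,
    entropy_kronecker hρ.reducedA.1.isHermitian hρ.reducedB.1.isHermitian, hρ.reducedA.trace_re,
    hρ.reducedB.trace_re, mul_one, one_mul, sub_self]

theorem abs_mutualInfo_sub_le (hρ : IsState ρ) (hσ : IsState σ) {ε : ℝ}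
    (hε : ε = traceNorm (ρ - σ) / 2) :
    |mutualInfo ρ - mutualInfo σ| ≤
      3 * ε * Real.logb 2 (Fintype.card A) + 2 * ((1 + ε) * binaryEntropy (ε / (1 + ε))) := by
  have reduced := isAlmostAffine_entropy_reducedA.abs_sub_le
    (fun _ h => entropy_nonneg h.reducedA) (fun _ h => entropy_le_logb_card h.reducedA) hρ hσ hε
  have conditional := isAlmostAffine_condEntropy.abs_sub_le
    (fun _ => neg_logb_card_le_condEntropy) (fun _ => condEntropy_le_logb_card) hρ hσ hε
  rw [mutualInfo_eq_entropy_sub_condEntropy, mutualInfo_eq_entropy_sub_condEntropy,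
    sub_sub_sub_comm]
  refine (abs_sub _ _).trans ?_
  linarith

theorem abs_mutualInfo_sub_le_three_mul_logb_card (hρ : IsState ρ) (hσ : IsState σ) :
    |mutualInfo ρ - mutualInfo σ| ≤ 3 * Real.logb 2 (Fintype.card A) := by
  rw [mutualInfo_eq_entropy_sub_condEntropy, mutualInfo_eq_entropy_sub_condEntropy, abs_le]
  constructor <;>
    linarith [entropy_nonneg hρ.reducedA, entropy_nonneg hσ.reducedA,
      entropy_le_logb_card hρ.reducedA, entropy_le_logb_card hσ.reducedA,
      neg_logb_card_le_condEntropy hρ, neg_logb_card_le_condEntropy hσ,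
      condEntropy_le_logb_card hρ, condEntropy_le_logb_card hσ]

theorem abs_mutualInfo_sub_le_of_traceNorm_le_one (hρ : IsState ρ) (hσ : IsState σ)
    (h : traceNorm (ρ - σ) ≤ 1) :
    |mutualInfo ρ - mutualInfo σ| ≤
      6 * traceNorm (ρ - σ) * Real.logb 2 (Fintype.card A) +
        4 * binaryEntropy (traceNorm (ρ - σ)) := by
  have h0 := traceNorm_nonneg (hρ.1.isHermitian.sub hσ.1.isHermitian)
  generalize hδ : traceNorm (ρ - σ) = δ at h h0 ⊢
  have binaryEntropy_nonneg := binaryEntropy_nonneg h0 h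
  rcases (Nat.succ_le_of_lt hρ.reducedA.card_pos).eq_or_lt with card_eq_one | one_lt_card
  · have := abs_mutualInfo_sub_le_three_mul_logb_card hρ hσ
    simp only [← card_eq_one, Nat.succ_eq_add_one, zero_add, Nat.cast_one, Real.logb_one, mul_zero]
      at this ⊢
    linarith
  · have one_le_logb : 1 ≤ Real.logb 2 (Fintype.card A) := by
      rw [Real.le_logb_iff_rpow_le one_lt_two (Nat.cast_pos.2 hρ.reducedA.card_pos), Real.rpow_one]
      exact_mod_cast one_lt_card
    have sharp := abs_mutualInfo_sub_le hρ hσ (congrArg (· / 2) hδ.symm)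
    have mixing := one_add_mul_binaryEntropy_le (div_nonneg h0 zero_le_two)
      (by linarith : δ / 2 ≤ 1 / 2)
    rw [mul_div_cancel₀ δ two_ne_zero] at mixing
    linarith [mul_le_mul_of_nonneg_left one_le_logb h0]

end MutualInformation

end QInfo

end

theorem mainTheorem5 {A B : Type*} [Fintype A] [DecidableEq A] [Fintype B] [DecidableEq B]
    (ρ : Matrix (A × B) (A × B) ℂ) (hρ : QInfo.IsState ρ) :
    (∀ (σ : Matrix (A × B) (A × B) ℂ) (δ : ℝ), QInfo.IsState σ →
      δ = QInfo.traceNorm (ρ - σ) → δ < 1 →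
      |QInfo.mutualInfo ρ - QInfo.mutualInfo σ| ≤
        6 * δ * Real.logb 2 (Fintype.card A) + 4 * QInfo.binaryEntropy δ) ∧
    QInfo.IsState (QInfo.productOfReduced ρ) ∧
    QInfo.mutualInfo (QInfo.productOfReduced ρ) = 0 ∧
    (QInfo.traceDistCorr ρ < 1 →
      QInfo.mutualInfo ρ ≤
        6 * QInfo.traceDistCorr ρ * Real.logb 2 (Fintype.card A) +
          4 * QInfo.binaryEntropy (QInfo.traceDistCorr ρ)) := by
  have product_isState : QInfo.IsState (QInfo.productOfReduced ρ) :=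
    QInfo.isState_kronecker hρ.reducedA hρ.reducedB
  have product_mutualInfo := QInfo.mutualInfo_productOfReduced hρ
  refine ⟨fun σ δ hσ hδ hδ1 => ?_, product_isState, product_mutualInfo, fun hT => ?_⟩
  · subst hδ
    exact QInfo.abs_mutualInfo_sub_le_of_traceNorm_le_one hρ hσ hδ1.le
  · have h := QInfo.abs_mutualInfo_sub_le_of_traceNorm_le_one hρ product_isState hT.le
    rw [product_mutualInfo, sub_zero] at h
    exact (le_abs_self _).trans h
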